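/- Let $\Gamma=\mathrm{Gal}(\mathbb C/\mathbb R)=\{1,\gamma\}$, where $\gamma$ is complex conjugation. For a $\Gamma$-module $A$ (written additively) and $k\in\mathbb Z$, let $$H^k A=Z^kA/B^kA,\qquad Z^kA=\{a\in A\mid {}^{\gamma}a=(-1)^k a\},\qquad B^kA=\{{}^{\gamma}a'+(-1)^k a'\mid a'\in A\}$$ denote the $k$-th Tate cohomology group of $\Gamma$ with coefficients in $A$. Let $\mathbf T$ be an $\mathbb R$-torus, $T=\mathbf T\times_{\mathbb R}\mathbb C$, and let $X_*(\mathbf T)=\mathrm{Hom}(\mathbb G_{m,\mathbb C},T)$ be its group of complex cocharacters, on which $\Gamma$ acts by $({}^{\gamma}\nu)(z)={}^{\gamma}\big(\nu({}^{\gamma^{-1}}z)\big)$ for $z\in\mathbb C^\times$. Write $H^k\mathbf T$ for $H^k(\mathbf T(\mathbb C))$. (i) The evaluation map $$\mathrm{ev}\colon X_*(\mathbf T)\to \mathbf T(\mathbb C),\qquad \nu\mapsto\nu(-1),$$ is a $\Gamma$-equivariant homomorphism, and for every $k\in\mathbb Z$ the induced homomorphism $$\mathrm{ev}^k_*\colon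 H^kX_*(\mathbf T)\to H^k\mathbf T,\qquad [\nu]\mapsto[\nu(-1)],$$ is an isomorphism. (ii) The homomorphism $\mathbf T(\mathbb R)=Z^0\mathbf T\to H^0\mathbf T$, $t\mapsto[t]$, induces an isomorphism $\pi_0\mathbf T(\mathbb R)\cong H^0\mathbf T$ from the group of connected components of the real Lie group $\mathbf T(\mathbb R)$. Consequently there are isomorphisms $$H^0X_*(\mathbf T)\xrightarrow{\ \mathrm{ev}^0_*\ }H^0\mathbf T\cong\pi_0\mathbf T(\mathbb R),$$ whose composite sends $[\nu]$ to the connected component of $\nu(-1)\in\mathbf T(\mathbb R)$. -/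

import Mathlib

open scoped TensorProduct LaurentPolynomial

noncomputable section

namespace RealTori

open Coalgebra WithConv

/-! ### Tate cohomology of `Γ = Gal(ℂ/ℝ)` -/

/-- The nontrivial element `γ` of `Γ = Gal(ℂ/ℝ)`: complex conjugation. -/
def conj : Gal(ℂ/ℝ) := Complex.conjAe

section Tate

variable (M : Type*) [AddCommGroup M] [DistribMulAction Gal(ℂ/ℝ) M]

/-- The coboundary operator `d^k : M → M`, `a ↦ γ a + (-1)^(k+1) a`, for `k : ℤ`. -/
def tateD (k : ℤ) : M →+ M where
  toFun a := conj • a + ((k + 1).negOnePow : ℤ) • a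
  map_zero' := by simp
  map_add' a b := by simp only [smul_add]; abel

/-- The `k`-cocycles `Z^k M = ker d^k = {a | γ a = (-1)^k a}`. -/
def tateZ (k : ℤ) : AddSubgroup M := (tateD M k).ker

/-- The `k`-coboundaries `B^k M = im d^(k-1) = {γ a + (-1)^k a}`. -/
def tateB (k : ℤ) : AddSubgroup M := (tateD M (k - 1)).range

/-- The Tate cohomology group `H^k M = Z^k M / B^k M`, for `k : ℤ`. -/
abbrev TateH (k : ℤ) : Type _ := tateZ M k ⧸ (tateB M k).addSubgroupOf (tateZ M k)

variable {M}

theorem mem_tateZ_iff {k : ℤ} {a : M} :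
    a ∈ tateZ M k ↔ conj • a = (k.negOnePow : ℤ) • a := by
  change conj • a + ((k + 1).negOnePow : ℤ) • a = 0 ↔ _
  rw [Int.negOnePow_succ, Units.val_neg, neg_smul, ← sub_eq_add_neg, sub_eq_zero]

theorem mem_tateB_iff {k : ℤ} {a : M} :
    a ∈ tateB M k ↔ ∃ b : M, conj • b + (k.negOnePow : ℤ) • b = a := by
  change (∃ b : M, conj • b + ((k - 1 + 1).negOnePow : ℤ) • b = a) ↔ _
  rw [sub_add_cancel]

variable {N : Type*} [AddCommGroup N] [DistribMulAction Gal(ℂ/ℝ) N]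

theorem map_tateD (f : M →+[Gal(ℂ/ℝ)] N) (k : ℤ) (a : M) :
    f (tateD M k a) = tateD N k (f a) := by
  change f (conj • a + ((k + 1).negOnePow : ℤ) • a) = conj • f a + ((k + 1).negOnePow : ℤ) • f a
  rw [map_add, map_smul]
  congr 1
  exact map_zsmul (f : M →+ N) _ _

/-- The map `Z^k M → Z^k N` induced by a `Γ`-equivariant homomorphism `f : M → N`. -/
def tateZMap (f : M →+[Gal(ℂ/ℝ)] N) (k : ℤ) : tateZ M k →+ tateZ N k :=
  ((f : M →+ N).comp (tateZ M k).subtype).codRestrict (tateZ N k) fun a => by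
    change tateD N k (f a) = 0
    rw [← map_tateD, (show tateD M k a = 0 from a.2), map_zero]

/-- The map `H^k M → H^k N`, `[a] ↦ [f a]`, induced by a `Γ`-equivariant homomorphism
`f : M → N`. -/
def tateHMap (f : M →+[Gal(ℂ/ℝ)] N) (k : ℤ) : TateH M k →+ TateH N k :=
  QuotientAddGroup.map _ _ (tateZMap f k) <| by
    rintro ⟨a, ha⟩ hb
    obtain ⟨b, hb⟩ := AddSubgroup.mem_addSubgroupOf.1 hb
    refine AddSubgroup.mem_addSubgroupOf.2 (AddMonoidHom.mem_range.2 ⟨f b, ?_⟩)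
    rw [← map_tateD, hb]
    rfl

/-- A `Γ`-module written multiplicatively, rewritten additively. -/
instance {G : Type*} [CommGroup G] [MulDistribMulAction Gal(ℂ/ℝ) G] :
    DistribMulAction Gal(ℂ/ℝ) (Additive G) where
  smul σ x := .ofMul (σ • x.toMul)
  one_smul x := congrArg Additive.ofMul (one_smul _ x.toMul)
  mul_smul σ τ x := congrArg Additive.ofMul (mul_smul σ τ x.toMul)
  smul_zero σ := congrArg Additive.ofMul (smul_one (N := G) σ)
  smul_add σ x y := congrArg Additive.ofMul (smul_mul' σ x.toMul y.toMul)

end Tate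

/-! ### Tori over `ℝ` -/

variable (A : Type*) [CommRing A] [HopfAlgebra ℝ A]

/-- The affine `ℝ`-group `𝐓` with coordinate ring `A = ℝ[𝐓]` is a torus: its base change to `ℂ`
is isomorphic, as an algebraic group, to `(𝔾_{m,ℂ})^n` for some `n`, whose coordinate ring is the
Hopf algebra `ℂ[ℤ^n]` of Laurent polynomials in `n` variables. -/
class IsRealTorus : Prop where
  exists_equiv : ∃ n : ℕ, Nonempty (ℂ ⊗[ℝ] A ≃ₐc[ℂ] AddMonoidAlgebra ℂ (Fin n → ℤ))

/-- A torus is commutative, that is, its coordinate ring is cocommutative. -/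
instance isCocomm_of_isRealTorus [IsRealTorus A] : IsCocomm ℝ A := by
  obtain ⟨n, ⟨e⟩⟩ := IsRealTorus.exists_equiv (A := A)
  have hC : ∀ x : ℂ ⊗[ℝ] A, TensorProduct.comm ℂ _ _ (comul (R := ℂ) x) = comul (R := ℂ) x := by
    intro x
    obtain ⟨y, rfl⟩ : ∃ y, e.symm y = x := ⟨e x, e.symm_apply_apply x⟩
    rw [← CoalgHomClass.map_comp_comul_apply e.symm y, ← TensorProduct.map_comm, comm_comul]
  refine ⟨LinearMap.ext fun a => ?_⟩
  have hinj : Function.Injective fun x : A ⊗[ℝ] A =>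
      TensorProduct.AlgebraTensorModule.distribBaseChange ℝ ℂ A A ((1 : ℂ) ⊗ₜ x) :=
    (LinearEquiv.injective _).comp
      (Algebra.TensorProduct.includeRight_injective (R := ℝ) (A := ℂ) (B := A ⊗[ℝ] A)
        (algebraMap ℝ ℂ).injective)
  apply hinj
  have h := hC ((1 : ℂ) ⊗ₜ a)
  have key : ∀ z : A ⊗[ℝ] A, TensorProduct.comm ℂ _ _
      (TensorProduct.AlgebraTensorModule.distribBaseChange ℝ ℂ A A ((1 : ℂ) ⊗ₜ z)) =
      TensorProduct.AlgebraTensorModule.distribBaseChange ℝ ℂ A A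
        ((1 : ℂ) ⊗ₜ (TensorProduct.comm ℝ A A z)) := by
    intro z
    induction z with
    | zero => simp
    | add x y hx hy => simp only [TensorProduct.tmul_add, map_add, hx, hy]
    | tmul x y => simp
  have hcomul : comul (R := ℂ) ((1 : ℂ) ⊗ₜ[ℝ] a) =
      TensorProduct.AlgebraTensorModule.distribBaseChange ℝ ℂ A A
        ((1 : ℂ) ⊗ₜ (comul (R := ℝ) a)) := by
    rw [← (ℛ ℝ a).eq]
    simp [← (ℛ ℝ a).eq, TensorProduct.tmul_sum]
  rw [hcomul, key] at h
  exact h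

/-! ### Points -/

/-- The group `𝐓(R) = Hom_{ℝ-alg}(A, R)` of `R`-points of the affine `ℝ`-group `𝐓` with coordinate
ring `A`; the group law is convolution, i.e. it comes from the comultiplication of `A`. -/
abbrev Points (R : Type*) [CommRing R] [Algebra ℝ R] : Type _ := WithConv (A →ₐ[ℝ] R)

variable {A}

/-- The homomorphism `𝐓(R) → 𝐓(S)` induced by a homomorphism of `ℝ`-algebras `R → S`. -/
def Points.map {R S : Type*} [CommRing R] [Algebra ℝ R] [CommRing S] [Algebra ℝ S]
    (φ : R →ₐ[ℝ] S) : Points A R →* Points A S where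
  toFun t := toConv (φ.comp t.ofConv)
  map_one' := by
    ext a
    simp [AlgHom.convOne_def]
  map_mul' s t := by
    rw [AlgHom.comp_convMul_distrib]

theorem Points.mul_apply {R : Type*} [CommRing R] [Algebra ℝ R] (s t : Points A R) (a : A) :
    (s * t) a = ∑ i ∈ (ℛ ℝ a).index, s ((ℛ ℝ a).left i) * t ((ℛ ℝ a).right i) := by
  rw [AlgHom.convMul_apply]
  conv_lhs => rw [← (ℛ ℝ a).eq]
  rw [map_sum]
  exact Finset.sum_congr rfl fun i _ => Algebra.TensorProduct.lift_tmul _ _ _ _ _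

/-- The inverse of `t ∈ 𝐓(ℂ)` is the composite of `t` with the antipode of `A`. -/
instance : Inv (Points A ℂ) where
  inv t := toConv (t.ofConv.comp (HopfAlgebra.antipodeAlgHom ℝ A))

instance [IsCocomm ℝ A] : CommGroup (Points A ℂ) where
  inv_mul_cancel t := by
    apply ofConv_injective
    ext a
    change (t⁻¹ * t) a = algebraMap ℝ ℂ (counit (R := ℝ) a)
    rw [Points.mul_apply, ← t.ofConv.commutes,
      ← HopfAlgebra.sum_antipode_mul_eq_algebraMap_counit (ℛ ℝ a), map_sum]
    exact Finset.sum_congr rfl fun i _ => (map_mul t.ofConv _ _).symm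

/-- The action of `Γ = Gal(ℂ/ℝ)` on `𝐓(ℂ)`: `(σ t)(f) = σ (t f)` for `f ∈ A`. -/
instance : MulDistribMulAction Gal(ℂ/ℝ) (Points A ℂ) where
  smul σ t := Points.map σ.toAlgHom t
  one_smul _ := rfl
  mul_smul _ _ _ := rfl
  smul_mul _ s t := map_mul _ s t
  smul_one _ := map_one _

theorem smul_point_apply (σ : Gal(ℂ/ℝ)) (t : Points A ℂ) (a : A) : (σ • t) a = σ (t a) := rfl

/-- The embedding of `𝐓(ℝ)` into `𝐓(ℂ)`. -/
def realToComplex : Points A ℝ →* Points A ℂ := Points.map (Algebra.ofId ℝ ℂ)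

/-- The topology of the real Lie group `𝐓(ℝ)`: the coarsest one such that every regular function
`f ∈ A` is continuous on `𝐓(ℝ)`; for a closed embedding of `𝐓` into an affine space, this is the
topology induced from `ℝ^N`. -/
instance : TopologicalSpace (Points A ℝ) := .induced (fun t (a : A) => t a) inferInstance

theorem continuous_point_apply (a : A) : Continuous fun t : Points A ℝ => t a :=
  (continuous_apply a).comp continuous_induced_dom

instance : IsTopologicalGroup (Points A ℝ) where
  continuous_mul := by
    refine continuous_induced_rng.2 (continuous_pi fun a => ?_)
    change Continuous fun p : Points A ℝ × Points A ℝ => (p.1 * p.2) a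
    simp only [Points.mul_apply]
    exact continuous_finsetSum _ fun i _ =>
      ((continuous_point_apply _).comp continuous_fst).mul
        ((continuous_point_apply _).comp continuous_snd)
  continuous_inv := by
    refine continuous_induced_rng.2 (continuous_pi fun a => ?_)
    exact continuous_point_apply (HopfAlgebra.antipode ℝ a)

variable (A) in
/-- The group `π₀ 𝐓(ℝ) = 𝐓(ℝ) / 𝐓(ℝ)⁰` of connected components of the real Lie group `𝐓(ℝ)`. -/
abbrev PiZeroReal : Type _ := Points A ℝ ⧸ Subgroup.connectedComponentOfOne (Points A ℝ)

/-- The homomorphism `𝐓(ℝ) → Z⁰ 𝐓(ℂ) = 𝐓(ℂ)^Γ`, which identifies `𝐓(ℝ)` with the group of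
0-cocycles. -/
def realToZ0 [IsCocomm ℝ A] : Additive (Points A ℝ) →+ tateZ (Additive (Points A ℂ)) 0 :=
  (MonoidHom.toAdditive realToComplex).codRestrict _ fun t => by
    rw [mem_tateZ_iff, Int.negOnePow_zero, Units.val_one, one_smul]
    refine congrArg Additive.ofMul (ofConv_injective (AlgHom.ext fun a => ?_))
    exact conj.commutes (t.toMul a)

variable (A) in
/-- The homomorphism `𝐓(ℝ) → H⁰ 𝐓(ℂ)`, `t ↦ [t]`. -/
def realToH0 [IsCocomm ℝ A] : Additive (Points A ℝ) →+ TateH (Additive (Points A ℂ)) 0 :=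
  (QuotientAddGroup.mk' _).comp realToZ0

/-! ### Cocharacters -/

variable (A) in
/-- The group `X_*(𝐓) = Hom(𝔾_{m,ℂ}, T)` of complex cocharacters, where `T = 𝐓 ×_ℝ ℂ`:
homomorphisms of Hopf algebras over `ℂ` from `ℂ[T] = ℂ ⊗ A` to `ℂ[𝔾_m] = ℂ[T, T⁻¹]`. The group law
(pointwise multiplication of homomorphisms into `T`) is convolution. -/
abbrev Cochar : Type _ := WithConv (ℂ ⊗[ℝ] A →ₐc[ℂ] ℂ[T;T⁻¹])

section Cochar

/-- The inversion `z ↦ z⁻¹` of `𝔾_{m,ℂ}`. -/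
def invGm : ℂ[T;T⁻¹] →ₐc[ℂ] ℂ[T;T⁻¹] :=
  AddMonoidAlgebra.mapDomainBialgHom ℂ (-AddMonoidHom.id ℤ)

theorem Cochar.ext_tmul {ν μ : Cochar A} (h : ∀ a : A, ν (1 ⊗ₜ a) = μ (1 ⊗ₜ a)) : ν = μ := by
  apply ofConv_injective
  apply BialgHom.coe_toAlgHom_injective
  apply Algebra.TensorProduct.ext_ring
  exact AlgHom.ext h

theorem comul_one_tmul (a : A) : comul (R := ℂ) ((1 : ℂ) ⊗ₜ[ℝ] a) =
    ∑ i ∈ (ℛ ℝ a).index, ((1 : ℂ) ⊗ₜ[ℝ] (ℛ ℝ a).left i) ⊗ₜ[ℂ]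
      ((1 : ℂ) ⊗ₜ[ℝ] (ℛ ℝ a).right i) := by
  rw [TensorProduct.comul_tmul]
  conv_lhs => rw [← (ℛ ℝ a).eq]
  simp [TensorProduct.tmul_sum]

theorem Cochar.mul_tmul [IsCocomm ℝ A] (ν μ : Cochar A) (a : A) : (ν * μ) (1 ⊗ₜ a) =
    ∑ i ∈ (ℛ ℝ a).index, ν (1 ⊗ₜ (ℛ ℝ a).left i) * μ (1 ⊗ₜ (ℛ ℝ a).right i) := by
  have h : (ν * μ) (1 ⊗ₜ a) =
      (toConv ν.ofConv.toAlgHom * toConv μ.ofConv.toAlgHom) (1 ⊗ₜ[ℝ] a) := by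
    rw [← BialgHom.toAlgHom_convMul]
    rfl
  rw [h, AlgHom.convMul_apply, comul_one_tmul, map_sum]
  exact Finset.sum_congr rfl fun i _ => Algebra.TensorProduct.lift_tmul _ _ _ _ _

theorem invGm_T (n : ℤ) : invGm (.T n) = .T (-n) := by
  exact AddMonoidAlgebra.mapDomainBialgHom_single _ _ _

theorem invGm_mul : (toConv invGm.toAlgHom * toConv (AlgHom.id ℂ ℂ[T;T⁻¹]) :
    WithConv (ℂ[T;T⁻¹] →ₐ[ℂ] ℂ[T;T⁻¹])) = 1 := by
  apply ofConv_injective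
  refine AddMonoidAlgebra.algHom_ext (A := ℂ) (B := ℂ[T;T⁻¹]) (R := ℂ) (fun n => ?_) (by ext)
  change (toConv invGm.toAlgHom * toConv (AlgHom.id ℂ ℂ[T;T⁻¹])) (.T n) =
    algebraMap ℂ ℂ[T;T⁻¹] (counit (R := ℂ) (.T n : ℂ[T;T⁻¹]))
  rw [AlgHom.convMul_apply, LaurentPolynomial.comul_T, LaurentPolynomial.counit_T, map_one]
  refine (Algebra.TensorProduct.lift_tmul _ _ _ _ _).trans ?_
  change invGm (.T n) * .T n = 1
  rw [invGm_T, ← LaurentPolynomial.T_add, neg_add_cancel, LaurentPolynomial.T_zero]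

instance [IsCocomm ℝ A] : Inv (Cochar A) where
  inv ν := toConv (invGm.comp ν.ofConv)

instance [IsCocomm ℝ A] : CommGroup (Cochar A) where
  inv_mul_cancel ν := by
    apply ofConv_injective
    apply BialgHom.coe_toAlgHom_injective
    have h : ((ν⁻¹ * ν).ofConv : ℂ ⊗[ℝ] A →ₐ[ℂ] ℂ[T;T⁻¹]) =
        (toConv invGm.toAlgHom * toConv (AlgHom.id ℂ ℂ[T;T⁻¹])).ofConv.comp
          (ν.ofConv : ℂ ⊗[ℝ] A →ₐ[ℂ] ℂ[T;T⁻¹]) := by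
      rw [AlgHom.convMul_comp_bialgHom_distrib]
      rfl
    rw [h, invGm_mul]
    apply Algebra.TensorProduct.ext_ring
    ext x : 1
    change algebraMap ℂ ℂ[T;T⁻¹] (counit (R := ℂ) (ν (1 ⊗ₜ x))) =
      algebraMap ℂ ℂ[T;T⁻¹] (counit (R := ℂ) ((1 : ℂ) ⊗ₜ[ℝ] x))
    rw [CoalgHomClass.counit_comp_apply]

/-- The semilinear action of `σ` on the coefficients of Laurent polynomials. -/
def coeffMap (σ : Gal(ℂ/ℝ)) : ℂ[T;T⁻¹] →+* ℂ[T;T⁻¹] :=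
  AddMonoidAlgebra.mapRingHom ℤ (σ : ℂ →+* ℂ)

theorem coeffMap_algebraMap (σ : Gal(ℂ/ℝ)) (c : ℂ) :
    coeffMap σ (algebraMap ℂ ℂ[T;T⁻¹] c) = algebraMap ℂ ℂ[T;T⁻¹] (σ c) :=
  AddMonoidAlgebra.mapRingHom_single _ _ _

/-- For a homomorphism `ν` of `ℂ`-algebras, the `ℂ`-algebra homomorphism
`(σ on coefficients) ∘ ν ∘ (σ⁻¹ ⊗ id)`. -/
def twistAlgHom (σ : Gal(ℂ/ℝ)) (ν : ℂ ⊗[ℝ] A →ₐ[ℂ] ℂ[T;T⁻¹]) :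
    ℂ ⊗[ℝ] A →ₐ[ℂ] ℂ[T;T⁻¹] where
  toRingHom := (coeffMap σ).comp ((ν : ℂ ⊗[ℝ] A →+* ℂ[T;T⁻¹]).comp
    (Algebra.TensorProduct.map (σ⁻¹ : Gal(ℂ/ℝ)).toAlgHom (AlgHom.id ℝ A) :
      ℂ ⊗[ℝ] A →+* ℂ ⊗[ℝ] A))
  commutes' c := by
    change coeffMap σ (ν (algebraMap ℂ (ℂ ⊗[ℝ] A) (σ⁻¹ c))) = _
    rw [AlgHom.commutes, coeffMap_algebraMap]
    congr 1
    exact σ.apply_symm_apply c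

theorem twistAlgHom_tmul (σ : Gal(ℂ/ℝ)) (ν : ℂ ⊗[ℝ] A →ₐ[ℂ] ℂ[T;T⁻¹]) (a : A) :
    twistAlgHom σ ν (1 ⊗ₜ a) = coeffMap σ (ν (1 ⊗ₜ a)) := by
  change coeffMap σ (ν ((σ⁻¹ : Gal(ℂ/ℝ)) 1 ⊗ₜ a)) = _
  rw [map_one]

theorem counit_comp_twistAlgHom (σ : Gal(ℂ/ℝ)) (ν : ℂ ⊗[ℝ] A →ₐc[ℂ] ℂ[T;T⁻¹]) :
    (Bialgebra.counitAlgHom ℂ ℂ[T;T⁻¹]).comp (twistAlgHom σ ν) =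
      Bialgebra.counitAlgHom ℂ (ℂ ⊗[ℝ] A) := by
  apply Algebra.TensorProduct.ext_ring
  ext a
  change counit (R := ℂ) (twistAlgHom σ (ν : ℂ ⊗[ℝ] A →ₐ[ℂ] ℂ[T;T⁻¹]) (1 ⊗ₜ a)) =
    counit (R := ℂ) ((1 : ℂ) ⊗ₜ[ℝ] a)
  rw [twistAlgHom_tmul]
  have h := RingHom.congr_fun
    (AddMonoidAlgebra.counitAlgHom_comp_mapRingHom (M := ℤ) (σ : ℂ →+* ℂ)) (ν (1 ⊗ₜ a))
  refine h.trans ?_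
  change σ (counit (R := ℂ) (ν (1 ⊗ₜ a))) = _
  rw [CoalgHomClass.counit_comp_apply]
  simp only [TensorProduct.counit_tmul, CommSemiring.counit_apply, Algebra.smul_def, mul_one]
  exact σ.commutes _

theorem map_comp_comul_twistAlgHom (σ : Gal(ℂ/ℝ)) (ν : ℂ ⊗[ℝ] A →ₐc[ℂ] ℂ[T;T⁻¹]) :
    (Algebra.TensorProduct.map (twistAlgHom σ ν) (twistAlgHom σ ν)).comp
      (Bialgebra.comulAlgHom ℂ (ℂ ⊗[ℝ] A)) =
      (Bialgebra.comulAlgHom ℂ ℂ[T;T⁻¹]).comp (twistAlgHom σ ν) := by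
  apply Algebra.TensorProduct.ext_ring
  ext a : 1
  change Algebra.TensorProduct.map _ _ (comul (R := ℂ) ((1 : ℂ) ⊗ₜ[ℝ] a)) =
    comul (R := ℂ) (twistAlgHom σ (ν : ℂ ⊗[ℝ] A →ₐ[ℂ] ℂ[T;T⁻¹]) (1 ⊗ₜ a))
  rw [twistAlgHom_tmul]
  have h := RingHom.congr_fun
    (AddMonoidAlgebra.comulAlgHom_comp_mapRingHom (M := ℤ) (σ : ℂ →+* ℂ)) (ν (1 ⊗ₜ a))
  refine Eq.trans ?_ h.symm
  rw [RingHom.comp_apply]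
  have h2 : (Bialgebra.comulAlgHom ℂ (AddMonoidAlgebra ℂ ℤ)).toRingHom (ν (1 ⊗ₜ a)) =
      ∑ i ∈ (ℛ ℝ a).index, ν (1 ⊗ₜ (ℛ ℝ a).left i) ⊗ₜ[ℂ] ν (1 ⊗ₜ (ℛ ℝ a).right i) := by
    refine (CoalgHomClass.map_comp_comul_apply ν ((1 : ℂ) ⊗ₜ[ℝ] a)).symm.trans ?_
    rw [comul_one_tmul, map_sum]
    rfl
  rw [h2, comul_one_tmul, map_sum, map_sum]
  refine Finset.sum_congr rfl fun i _ => ?_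
  rw [Algebra.TensorProduct.map_tmul, twistAlgHom_tmul, twistAlgHom_tmul]
  exact (Algebra.TensorProduct.mapRingHom_tmul _ _ _ _ _ _ _).symm

/-- The cocharacter `σ ∘ ν ∘ σ⁻¹`, on points `z ↦ σ (ν (σ⁻¹ z))`, see `Cochar.smul_evalAt`. -/
def Cochar.twist (σ : Gal(ℂ/ℝ)) (ν : Cochar A) : Cochar A :=
  toConv <| BialgHom.ofAlgHom (twistAlgHom σ ν.ofConv) (counit_comp_twistAlgHom σ ν.ofConv)
    (map_comp_comul_twistAlgHom σ ν.ofConv)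

theorem Cochar.twist_tmul (σ : Gal(ℂ/ℝ)) (ν : Cochar A) (a : A) :
    (ν.twist σ).ofConv (1 ⊗ₜ a) = coeffMap σ (ν.ofConv (1 ⊗ₜ a)) := by
  change twistAlgHom σ (ν.ofConv : ℂ ⊗[ℝ] A →ₐ[ℂ] ℂ[T;T⁻¹]) (1 ⊗ₜ a) = _
  rw [twistAlgHom_tmul]
  rfl

/-- The action of `Γ = Gal(ℂ/ℝ)` on `X_*(𝐓)`: `(σ ν)(z) = σ (ν (σ⁻¹ z))`. -/
instance [IsCocomm ℝ A] : MulDistribMulAction Gal(ℂ/ℝ) (Cochar A) where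
  smul σ ν := ν.twist σ
  one_smul ν := Cochar.ext_tmul fun a => by
    refine (Cochar.twist_tmul _ _ _).trans ?_
    exact RingHom.congr_fun (AddMonoidAlgebra.mapRingHom_id (M := ℤ) (R := ℂ)) _
  mul_smul σ τ ν := Cochar.ext_tmul fun a => by
    refine (Cochar.twist_tmul _ _ _).trans (Eq.trans ?_ (Cochar.twist_tmul _ _ _).symm)
    refine Eq.trans ?_ (congrArg (coeffMap σ) (Cochar.twist_tmul _ _ _).symm)
    exact RingHom.congr_fun
      (AddMonoidAlgebra.mapRingHom_comp (M := ℤ) (σ : ℂ →+* ℂ) (τ : ℂ →+* ℂ)) _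
  smul_mul σ ν μ := Cochar.ext_tmul fun a => by
    refine (Cochar.twist_tmul _ _ _).trans ?_
    rw [Cochar.mul_tmul, Cochar.mul_tmul, map_sum]
    refine Finset.sum_congr rfl fun i _ => ?_
    rw [map_mul]
    exact congrArg₂ _ (Cochar.twist_tmul _ _ _).symm (Cochar.twist_tmul _ _ _).symm
  smul_one σ := Cochar.ext_tmul fun a => by
    refine (Cochar.twist_tmul _ _ _).trans ?_
    rw [BialgHom.convOne_apply, coeffMap_algebraMap]
    congr 1
    simp only [TensorProduct.counit_tmul, CommSemiring.counit_apply, Algebra.smul_def, mul_one]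
    exact σ.commutes _

/-- Evaluation of regular functions on `𝔾_{m,ℂ}` at a point `z ∈ ℂˣ`. -/
def evalGm (z : ℂˣ) : ℂ[T;T⁻¹] →ₐ[ℂ] ℂ where
  toRingHom := LaurentPolynomial.eval₂ (RingHom.id ℂ) z
  commutes' c := LaurentPolynomial.eval₂_C _ _ c

/-- The value `ν(z) ∈ 𝐓(ℂ)` of a cocharacter `ν` at `z ∈ ℂˣ = 𝔾_m(ℂ)`; as a homomorphism `A → ℂ`
it is the composite `A → ℂ ⊗ A → ℂ[T, T⁻¹] → ℂ` of `a ↦ 1 ⊗ a`, `ν` and evaluation at `z`. -/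
def Cochar.evalAt (ν : Cochar A) (z : ℂˣ) : Points A ℂ :=
  toConv <| (((evalGm z).comp (ν.ofConv : ℂ ⊗[ℝ] A →ₐ[ℂ] ℂ[T;T⁻¹])).restrictScalars ℝ).comp
    Algebra.TensorProduct.includeRight

theorem Cochar.evalAt_apply (ν : Cochar A) (z : ℂˣ) (a : A) :
    ν.evalAt z a = evalGm z (ν (1 ⊗ₜ a)) := rfl

theorem evalGm_coeffMap (σ : Gal(ℂ/ℝ)) (z : ℂˣ) (p : ℂ[T;T⁻¹]) :
    evalGm (σ • z) (coeffMap σ p) = σ (evalGm z p) := by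
  induction p using LaurentPolynomial.induction_on' with
  | add p q hp hq => simp only [map_add, hp, hq]
  | C_mul_T n c =>
    have h : coeffMap σ (.C c * .T n) = .C (σ c) * .T n := by
      rw [← LaurentPolynomial.single_eq_C_mul_T, ← LaurentPolynomial.single_eq_C_mul_T]
      exact AddMonoidAlgebra.mapRingHom_single _ _ _
    rw [h]
    change LaurentPolynomial.eval₂ _ _ _ = σ (LaurentPolynomial.eval₂ _ _ _)
    rw [LaurentPolynomial.eval₂_C_mul_T, LaurentPolynomial.eval₂_C_mul_T, map_mul, ← smul_zpow']
    rfl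

/-- The action of `Γ` on cocharacters, on points: `(σ ν)(z) = σ (ν (σ⁻¹ z))`. -/
theorem Cochar.smul_evalAt [IsCocomm ℝ A] (σ : Gal(ℂ/ℝ)) (ν : Cochar A) (z : ℂˣ) :
    (σ • ν).evalAt z = σ • ν.evalAt (σ⁻¹ • z) := by
  apply ofConv_injective
  ext a
  change evalGm z ((ν.twist σ).ofConv (1 ⊗ₜ a)) = σ (evalGm (σ⁻¹ • z) (ν.ofConv (1 ⊗ₜ a)))
  rw [Cochar.twist_tmul, ← evalGm_coeffMap, smul_inv_smul]

theorem Cochar.evalAt_one [IsCocomm ℝ A] (z : ℂˣ) : (1 : Cochar A).evalAt z = 1 := by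
  apply ofConv_injective
  ext a
  change evalGm z (algebraMap ℂ ℂ[T;T⁻¹] (counit (R := ℂ) ((1 : ℂ) ⊗ₜ[ℝ] a))) =
    algebraMap ℝ ℂ (counit (R := ℝ) a)
  rw [AlgHom.commutes]
  simp

theorem Cochar.evalAt_mul [IsCocomm ℝ A] (ν μ : Cochar A) (z : ℂˣ) :
    (ν * μ).evalAt z = ν.evalAt z * μ.evalAt z := by
  apply ofConv_injective
  ext a
  change evalGm z ((ν * μ) (1 ⊗ₜ a)) = (ν.evalAt z * μ.evalAt z) a
  rw [Cochar.mul_tmul, Points.mul_apply]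
  simp only [map_sum, map_mul]
  rfl

variable (A) in
/-- The evaluation homomorphism `ev : X_*(𝐓) → 𝐓(ℂ)`, `ν ↦ ν(-1)`, a homomorphism of
`Γ`-modules. -/
def ev [IsCocomm ℝ A] : Additive (Cochar A) →+[Gal(ℂ/ℝ)] Additive (Points A ℂ) where
  toFun ν := .ofMul (ν.toMul.evalAt (-1))
  map_smul' σ ν := by
    have h : (σ⁻¹ : Gal(ℂ/ℝ)) • (-1 : ℂˣ) = -1 := by
      ext
      change (σ⁻¹ : Gal(ℂ/ℝ)) (-1 : ℂ) = -1
      rw [map_neg, map_one]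
    refine congrArg Additive.ofMul ((Cochar.smul_evalAt σ ν.toMul (-1)).trans ?_)
    rw [h]
    rfl
  map_zero' := congrArg Additive.ofMul (Cochar.evalAt_one _)
  map_add' ν μ := congrArg Additive.ofMul (Cochar.evalAt_mul ν.toMul μ.toMul _)

end Cochar

end RealTori

end

open RealTori

noncomputable section

namespace RealTori

open Coalgebra WithConv

/-! ### Tate cohomology across an exponential sequence -/

section Abstract

variable {Λ V T : Type*} [AddCommGroup Λ] [AddCommGroup V] [AddCommGroup T]
  [DistribMulAction Gal(ℂ/ℝ) Λ] [DistribMulAction Gal(ℂ/ℝ) T] [Module ℂ V]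

/-! Put V = ℂ ⊗ X_*(𝐓). The exponential `torusExp` : V → 𝐓(ℂ), z ⊗ ν ↦ ν(exp z), is equivariant and
surjective, with kernel 2πi ⊗ X_*(𝐓). Multiplication by 2 is invertible on V, so V has no Tate
cohomology and H^k 𝐓 is H^(k+1) of the kernel. Conjugation negates i, so the kernel is X_*(𝐓)
twisted by a sign, and the twist shifts the degree back to k. Since exp(πi) = -1, halving the kernel
elements realizes this isomorphism, up to sign, by ν ↦ ν(-1). `tateHMap_bijective_of_exp` carries
out the argument on cocycles, without a long exact sequence.

For π₀, every class in H⁰ 𝐓 comes from a real point, and the kernel of 𝐓(ℝ) → H⁰ 𝐓 is the group of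
norms γs·s. A norm is exp w with w fixed by conjugation, so the path x ↦ exp(xw) joins it to 1
inside 𝐓(ℝ) (`mem_connectedComponent_of_realToH0_eq_zero`). Conversely, a real point near 1 has a
small logarithm v, and γv - v is a kernel element too small to be nonzero; hence v is fixed and the
point is the norm of exp(v/2) (`isOpen_ker_realToH0Mul`). The group of norms is thus open, hence
closed, and equals the identity component. -/

theorem conj_smul_conj_smul {M : Type*} [AddCommGroup M] [DistribMulAction Gal(ℂ/ℝ) M] (a : M) :
    conj • conj • a = a := by
  have h : conj * conj = 1 := AlgEquiv.ext fun z => Complex.conj_conj z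
  rw [smul_smul, h, one_smul]

/-- Let `E : V → T` be an equivariant surjection from a complex vector space, whose kernel is
twice the image of an injection `J : Λ → V` that anticommutes with conjugation. Then `E ∘ J`
induces isomorphisms on Tate cohomology. -/
theorem tateHMap_bijective_of_exp (f : Λ →+[Gal(ℂ/ℝ)] T) (E : V →+ T) (c : V →+ V) (J : Λ →+ V)
    (hcc : ∀ v, c (c v) = v) (hEc : ∀ v, E (c v) = conj • E v)
    (hcJ : ∀ a, c (J a) = -J (conj • a)) (hJ : Function.Injective J) (hEJ : ∀ a, E (J a) = f a)
    (hE : Function.Surjective E) (hker : ∀ v, E v = 0 → ∃ a, v = (2 : ℂ) • J a) (k : ℤ) :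
    Function.Bijective (tateHMap f k) := by
  have two_inj : ∀ x y : V, x + x = y + y → x = y := fun x y h => by
    rw [← two_smul ℂ x, ← two_smul ℂ y] at h
    exact smul_right_injective V two_ne_zero h
  have hε : (k.negOnePow : ℤ) = 1 ∨ (k.negOnePow : ℤ) = -1 := by
    rcases Int.units_eq_one_or k.negOnePow with h | h <;> simp [h]
  constructor
  · rw [injective_iff_map_eq_zero]
    intro x
    induction x using QuotientAddGroup.induction_on with | H x => ?_
    obtain ⟨a, ha⟩ := x
    intro h
    have h : f a ∈ tateB T k :=
      AddSubgroup.mem_addSubgroupOf.1 ((QuotientAddGroup.eq_zero_iff _).1 h)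
    refine (QuotientAddGroup.eq_zero_iff _).2 (AddSubgroup.mem_addSubgroupOf.2 ?_)
    rw [mem_tateZ_iff] at ha
    rw [mem_tateB_iff] at h
    obtain ⟨t, ht⟩ := h
    obtain ⟨v, rfl⟩ := hE t
    obtain ⟨b, hb⟩ := hker (J a - (c v + (k.negOnePow : ℤ) • v)) (by
      rw [map_sub, map_add, map_zsmul, hEJ, hEc, ht, sub_self])
    rw [two_smul] at hb
    -- With ε = (-1)^k, `hb` reads Ja - (cv + εv) = 2Jb. Its conjugate, multiplied by -ε, reads Ja +
    -- (cv + εv) = 2εJ(γb). Adding the two removes v and gives a = b + εγb, the coboundary of εb.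
    have hb' := congrArg c hb
    simp only [map_sub, map_add, map_zsmul, hcc, hcJ, ha] at hb'
    change a ∈ tateB Λ k
    rw [mem_tateB_iff]
    refine ⟨(k.negOnePow : ℤ) • b, ?_⟩
    apply hJ
    apply two_inj
    rcases hε with h1 | h1 <;> simp only [h1, one_smul, neg_smul,
      smul_neg, map_add, map_neg, neg_neg] at hb hb' ⊢
    · have e1 : J a = c v + v + (J b + J b) := by rw [← hb]; abel
      have e2 : J a = -(v + c v) + (J (conj • b) + J (conj • b)) := by
        rw [← neg_inj, ← sub_eq_zero, ← sub_eq_zero.2 hb']; abel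
      nth_rewrite 1 [e1]
      rw [e2]; abel
    · have e1 : J a = c v + -v + (J b + J b) := by rw [← hb]; abel
      have e2 : J a = v + -c v + (-J (conj • b) + -J (conj • b)) := by
        rw [← hb']; abel
      nth_rewrite 1 [e1]
      rw [e2]; abel
  · intro x
    induction x using QuotientAddGroup.induction_on with | H x => ?_
    obtain ⟨t, ht⟩ := x
    rw [mem_tateZ_iff] at ht
    obtain ⟨v, rfl⟩ := hE t
    obtain ⟨b, hb⟩ := hker (c v - (k.negOnePow : ℤ) • v) (by
      rw [map_sub, map_zsmul, hEc, ht, sub_self])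
    -- Halving v cancels the factor 2 in the kernel: cw - εw = Jb, with ε = (-1)^k. Conjugating this
    -- relation shows that b is a k-cocycle.
    obtain ⟨w, rfl⟩ : ∃ w : V, w + w = v :=
      ⟨(2⁻¹ : ℂ) • v, by rw [← two_smul ℂ, smul_inv_smul₀ two_ne_zero]⟩
    rw [two_smul] at hb
    have hb1 : c w - (k.negOnePow : ℤ) • w = J b := by
      apply two_inj
      rw [← hb, map_add, smul_add]; abel
    have hb' := congrArg c hb1
    simp only [map_sub, map_zsmul, hcc, hcJ] at hb'
    have hbZ : conj • b = (k.negOnePow : ℤ) • b := by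
      apply hJ
      rw [map_zsmul, ← hb1, ← neg_inj, ← hb']
      rcases hε with h1 | h1 <;> simp [h1]
    have haZ : -(k.negOnePow : ℤ) • b ∈ tateZ Λ k := by
      rw [neg_smul]
      refine neg_mem (zsmul_mem ?_ _)
      rwa [mem_tateZ_iff]
    -- The class of -εb works: εJb + 2w = εcw + w, which is the coboundary of εw.
    refine ⟨QuotientAddGroup.mk ⟨_, haZ⟩, QuotientAddGroup.eq.2 (AddSubgroup.mem_addSubgroupOf.2 ?_)⟩
    change -f (-(k.negOnePow : ℤ) • b) + E (w + w) ∈ tateB T k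
    rw [mem_tateB_iff]
    refine ⟨E ((k.negOnePow : ℤ) • w), ?_⟩
    rw [← hEJ, ← hEc, ← map_zsmul, ← map_neg, ← map_add, ← map_add, map_zsmul J, ← hb1]
    congr 1
    rcases hε with h1 | h1 <;> simp only [h1, one_smul, neg_smul, smul_neg, map_neg] <;> abel

end Abstract

/-! ### Points and cocharacters evaluated on ℂ ⊗ A -/

section Characters

variable {A : Type*} [CommRing A] [HopfAlgebra ℝ A]

/-- The extension of a point of `𝐓(ℂ)`, a homomorphism `A → ℂ`, to `ℂ ⊗ A → ℂ`. -/
def Points.baseChange (t : Points A ℂ) : ℂ ⊗[ℝ] A →ₐ[ℂ] ℂ :=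
  Algebra.TensorProduct.lift (AlgHom.id ℂ ℂ) t.ofConv fun _ _ => Commute.all _ _

theorem Points.baseChange_tmul (t : Points A ℂ) (z : ℂ) (a : A) :
    t.baseChange (z ⊗ₜ a) = z * t a := Algebra.TensorProduct.lift_tmul _ _ _ _ _

theorem Points.baseChange_one_tmul (t : Points A ℂ) (a : A) : t.baseChange (1 ⊗ₜ a) = t a := by
  rw [baseChange_tmul, one_mul]

theorem Points.baseChange_injective :
    Function.Injective (Points.baseChange : Points A ℂ → ℂ ⊗[ℝ] A →ₐ[ℂ] ℂ) := fun s t h => by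
  apply ofConv_injective
  ext a
  have := DFunLike.congr_fun h (1 ⊗ₜ a)
  rwa [baseChange_one_tmul, baseChange_one_tmul] at this

theorem Points.baseChange_mul (s t : Points A ℂ) :
    toConv (s * t).baseChange = toConv s.baseChange * toConv t.baseChange := by
  apply ofConv_injective
  apply Algebra.TensorProduct.ext_ring
  ext a
  change (s * t).baseChange (1 ⊗ₜ a) = (toConv s.baseChange * toConv t.baseChange) (1 ⊗ₜ[ℝ] a)
  rw [baseChange_one_tmul, Points.mul_apply, AlgHom.convMul_apply, comul_one_tmul, map_sum]
  refine Finset.sum_congr rfl fun i _ => ?_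
  rw [← baseChange_one_tmul, ← baseChange_one_tmul]
  exact (Algebra.TensorProduct.lift_tmul _ _ _ _ _).symm

/-- The comultiplication sends a group-like x to x ⊗ x, which turns convolution into the product of
values: group-like elements are the characters of T. -/
theorem Points.baseChange_mul_apply (s t : Points A ℂ) {x : ℂ ⊗[ℝ] A} (hx : IsGroupLikeElem ℂ x) :
    (s * t).baseChange x = s.baseChange x * t.baseChange x := by
  have h := DFunLike.congr_fun (congrArg ofConv (Points.baseChange_mul s t)) x
  refine h.trans ?_
  refine (AlgHom.convMul_apply _ _ _).trans ?_
  rw [hx.comul_eq_tmul_self]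
  exact Algebra.TensorProduct.lift_tmul _ _ _ _ _

theorem Cochar.baseChange_evalAt (ν : Cochar A) (z : ℂˣ) (x : ℂ ⊗[ℝ] A) :
    (ν.evalAt z).baseChange x = evalGm z (ν x) := by
  have : (ν.evalAt z).baseChange = (evalGm z).comp (ν.ofConv : ℂ ⊗[ℝ] A →ₐ[ℂ] ℂ[T;T⁻¹]) := by
    apply Algebra.TensorProduct.ext_ring
    ext a
    exact Points.baseChange_one_tmul _ _
  exact DFunLike.congr_fun this x

theorem continuous_baseChange_realToComplex (x : ℂ ⊗[ℝ] A) :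
    Continuous fun t : Points A ℝ => (realToComplex t).baseChange x := by
  induction x with
  | zero => simpa using continuous_const
  | add x y hx hy => simp only [map_add]; exact hx.add hy
  | tmul z a =>
    simp only [Points.baseChange_tmul]
    exact continuous_const.mul (Complex.continuous_ofReal.comp (continuous_point_apply a))

theorem evalGm_T (z : ℂˣ) (n : ℤ) : evalGm z (.T n) = ((z ^ n : ℂˣ) : ℂ) := by
  change LaurentPolynomial.eval₂ _ _ _ = _
  simp

end Characters

/-! ### Coordinates on points and cocharacters from a splitting over ℂ -/

section Coordinates

variable {A : Type*} [CommRing A] [HopfAlgebra ℝ A] {n : ℕ}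
  (e : ℂ ⊗[ℝ] A ≃ₐc[ℂ] AddMonoidAlgebra ℂ (Fin n → ℤ))

/-- The character of `T` corresponding to `m : ℤ^n`, a group-like element of `ℂ[T] = ℂ ⊗ A`. -/
def character (m : Fin n → ℤ) : ℂ ⊗[ℝ] A := e.symm (AddMonoidAlgebra.single m 1)

theorem isGroupLikeElem_character (m : Fin n → ℤ) : IsGroupLikeElem ℂ (character e m) :=
  (AddMonoidAlgebra.isGroupLikeElem_single_one m).map e.symm

theorem character_zero : character e 0 = 1 := map_one e.symm

theorem character_add (m m' : Fin n → ℤ) :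
    character e (m + m') = character e m * character e m' := by
  rw [character, character, character, ← map_mul, AddMonoidAlgebra.single_mul_single, one_mul]

theorem character_neg_mul (m : Fin n → ℤ) : character e (-m) * character e m = 1 := by
  rw [← character_add, neg_add_cancel, character_zero]

/-- The values of a point of `𝐓(ℂ)` at the characters, as a homomorphism `ℤ^n → ℂˣ`. -/
def charValue (t : Points A ℂ) : (Fin n → ℤ) →+ Additive ℂˣ where
  toFun m := .ofMul
    { val := t.baseChange (character e m)
      inv := t.baseChange (character e (-m))
      val_inv := by rw [← map_mul, mul_comm, character_neg_mul, map_one]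
      inv_val := by rw [← map_mul, character_neg_mul, map_one] }
  map_zero' := by
    apply Additive.toMul.injective
    ext
    simp [character_zero]
  map_add' m m' := by
    apply Additive.toMul.injective
    ext
    simp [character_add]

/-- Under `e` the characters correspond to the monomials, which span the Laurent polynomial algebra.
-/
theorem charValue_injective : Function.Injective (charValue e) := fun s t h => by
  apply Points.baseChange_injective
  have h2 : s.baseChange.comp (e.symm : AddMonoidAlgebra ℂ (Fin n → ℤ) →ₐ[ℂ] ℂ ⊗[ℝ] A) =
      t.baseChange.comp (e.symm : AddMonoidAlgebra ℂ (Fin n → ℤ) →ₐ[ℂ] ℂ ⊗[ℝ] A) := by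
    refine AddMonoidAlgebra.algHom_ext (R := ℂ) (fun m => ?_) (by ext)
    exact congrArg (fun u : (Fin n → ℤ) →+ Additive ℂˣ => ((u m).toMul : ℂ)) h
  refine AlgHom.ext fun x => ?_
  have h3 := DFunLike.congr_fun h2 (e x)
  change s.baseChange (e.symm (e x)) = t.baseChange (e.symm (e x)) at h3
  rwa [e.symm_apply_apply] at h3

/-- A point of `𝐓(ℂ)` is determined by its values at a basis of characters. -/
theorem Points.ext_character {s t : Points A ℂ}
    (h : ∀ j, s.baseChange (character e (Pi.single j 1)) =
      t.baseChange (character e (Pi.single j 1))) : s = t := by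
  apply charValue_injective e
  refine AddMonoidHom.functions_ext _ _ _ fun j x => ?_
  have : (Pi.single j x : Fin n → ℤ) = x • Pi.single j 1 := by
    rw [← Pi.single_smul, smul_eq_mul, mul_one]
  rw [this, map_zsmul, map_zsmul]
  congr 1
  exact Additive.toMul.injective (Units.ext (h j))

/-- From 1 * 1 = 1 the value equals its own square, and it is nonzero because characters take unit
values. -/
theorem one_baseChange_character (m : Fin n → ℤ) :
    (1 : Points A ℂ).baseChange (character e m) = 1 := by
  have h := Points.baseChange_mul_apply (1 : Points A ℂ) 1 (isGroupLikeElem_character e m)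
  rw [mul_one] at h
  exact mul_left_cancel₀ (charValue e (1 : Points A ℂ) m).toMul.ne_zero
    (h.symm.trans (mul_one _).symm)

/-- The homomorphism `ℤ^n → ℤ` on characters induced by a cocharacter. -/
def Cochar.weight (ν : Cochar A) : (Fin n → ℤ) →+ ℤ :=
  AddMonoidAlgebra.mapDomainOfBialgHom
    (ν.ofConv.comp (e.symm : AddMonoidAlgebra ℂ (Fin n → ℤ) →ₐc[ℂ] ℂ ⊗[ℝ] A))

/-- Bialgebra homomorphisms preserve group-like elements, and those of ℂ[T;T⁻¹] are the powers of T.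
-/
theorem Cochar.apply_character (ν : Cochar A) (m : Fin n → ℤ) :
    ν (character e m) = .T (ν.weight e m) := by
  have h := AddMonoidAlgebra.mapDomainBialgHom_mapDomainOfBialgHom
    (ν.ofConv.comp (e.symm : AddMonoidAlgebra ℂ (Fin n → ℤ) →ₐc[ℂ] ℂ ⊗[ℝ] A))
  refine (DFunLike.congr_fun h (AddMonoidAlgebra.single m 1)).symm.trans ?_
  exact AddMonoidAlgebra.mapDomainBialgHom_single _ _ _

theorem Cochar.baseChange_evalAt_character (ν : Cochar A) (z : ℂˣ) (m : Fin n → ℤ) :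
    (ν.evalAt z).baseChange (character e m) = ((z ^ ν.weight e m : ℂˣ) : ℂ) := by
  rw [baseChange_evalAt, apply_character, evalGm_T]

/-- Cocharacters are the homomorphisms `ℤ^n → ℤ`. -/
def cocharEquiv : Cochar A ≃ ((Fin n → ℤ) →+ ℤ) where
  toFun ν := ν.weight e
  invFun f := toConv ((AddMonoidAlgebra.mapDomainBialgHom ℂ f).comp
    (e : ℂ ⊗[ℝ] A →ₐc[ℂ] AddMonoidAlgebra ℂ (Fin n → ℤ)))
  left_inv ν := by
    apply ofConv_injective
    ext x : 1
    change AddMonoidAlgebra.mapDomainBialgHom ℂ (ν.weight e) (e x) = ν.ofConv x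
    rw [Cochar.weight, AddMonoidAlgebra.mapDomainBialgHom_mapDomainOfBialgHom]
    exact congrArg ν.ofConv (e.symm_apply_apply x)
  right_inv f := by
    unfold Cochar.weight
    convert AddMonoidAlgebra.mapDomainOfBialgHom_mapDomainBialgHom (R := ℂ) f
    refine BialgHom.ext fun x => ?_
    exact congrArg (AddMonoidAlgebra.mapDomainBialgHom ℂ f) (e.apply_symm_apply x)

/-- The multiplicativity of a cocharacter on points. -/
theorem Cochar.evalAt_mul_right [IsRealTorus A] (ν : Cochar A) (z w : ℂˣ) :
    ν.evalAt (z * w) = ν.evalAt z * ν.evalAt w := by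
  obtain ⟨n, ⟨e⟩⟩ := IsRealTorus.exists_equiv (A := A)
  refine Points.ext_character e fun j => ?_
  rw [Points.baseChange_mul_apply _ _ (isGroupLikeElem_character e _)]
  simp only [baseChange_evalAt_character, mul_zpow, Units.val_mul]

variable [IsCocomm ℝ A]

/-- Since 2 is not a root of unity, a weight can be read off from the value of the cocharacter at z
= 2. This reduces additivity of weights to multiplicativity of evaluation. -/
theorem two_zpow_injective : Function.Injective fun k : ℤ =>
    (((Units.mk0 2 two_ne_zero : ℂˣ) ^ k : ℂˣ) : ℂ) := fun k l h => by
  have h := congrArg norm h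
  simpa using h

theorem Cochar.weight_mul (ν μ : Cochar A) : (ν * μ).weight e = ν.weight e + μ.weight e := by
  refine AddMonoidHom.ext fun m => ?_
  apply two_zpow_injective
  change _ = (((Units.mk0 2 two_ne_zero : ℂˣ) ^ (ν.weight e m + μ.weight e m) : ℂˣ) : ℂ)
  beta_reduce
  rw [zpow_add, Units.val_mul, ← baseChange_evalAt_character, ← baseChange_evalAt_character,
    ← baseChange_evalAt_character, evalAt_mul,
    Points.baseChange_mul_apply _ _ (isGroupLikeElem_character e m)]

/-- The isomorphism `X_*(𝐓) ≅ ℤ^n`, given by the weights on a basis of characters. -/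
def cocharAddEquiv : Additive (Cochar A) ≃+ (Fin n → ℤ) where
  toFun ν j := ν.toMul.weight e (Pi.single j 1)
  invFun f := .ofMul ((cocharEquiv e).symm
    (Pi.basisFun ℤ (Fin n) |>.constr ℤ f).toAddMonoidHom)
  left_inv ν := by
    apply Additive.toMul.injective
    apply (cocharEquiv e).injective
    refine ((cocharEquiv e).apply_symm_apply _).trans ?_
    have : ((Pi.basisFun ℤ (Fin n)).constr ℤ fun j => ν.toMul.weight e (Pi.single j 1)) =
        (ν.toMul.weight e).toIntLinearMap :=
      (Pi.basisFun ℤ (Fin n)).ext fun j => by rw [Module.Basis.constr_basis]; simp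
    rw [this]
    rfl
  right_inv f := by
    ext j
    have := DFunLike.congr_fun ((cocharEquiv e).apply_symm_apply
      (Pi.basisFun ℤ (Fin n) |>.constr ℤ f).toAddMonoidHom) (Pi.single j 1)
    refine this.trans ?_
    have h := (Pi.basisFun ℤ (Fin n)).constr_basis ℤ f j
    rwa [Pi.basisFun_apply] at h
  map_add' ν μ := by
    ext j
    exact DFunLike.congr_fun (Cochar.weight_mul e ν.toMul μ.toMul) _

/-- The basis of `X_*(𝐓)` dual to the basis of characters. -/
def cocharBasis : Module.Basis (Fin n) ℤ (Additive (Cochar A)) :=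
  .ofEquivFun (cocharAddEquiv e).toIntLinearEquiv

theorem cocharBasis_repr (ν : Additive (Cochar A)) (j : Fin n) :
    (cocharBasis e).repr ν j = ν.toMul.weight e (Pi.single j 1) := rfl

end Coordinates

/-! ### The exponential map of the torus and its kernel -/

section Exponential

variable {A : Type*} [CommRing A] [HopfAlgebra ℝ A] [IsRealTorus A]

/-- The complex exponential with values in `ℂˣ`. -/
def expUnit (z : ℂ) : ℂˣ := Units.mk0 (Complex.exp z) (Complex.exp_ne_zero z)

theorem expUnit_zero : expUnit 0 = 1 := Units.ext Complex.exp_zero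

theorem expUnit_add (z w : ℂ) : expUnit (z + w) = expUnit z * expUnit w :=
  Units.ext (Complex.exp_add z w)

theorem val_expUnit_zpow (z : ℂ) (k : ℤ) :
    ((expUnit z ^ k : ℂˣ) : ℂ) = Complex.exp (k • z) := by
  rw [Units.val_zpow_eq_zpow_val, zsmul_eq_mul, Complex.exp_int_mul]
  rfl

/-- The homomorphism `z ↦ ν(exp z)` from `ℂ` to `𝐓(ℂ)`. -/
def Cochar.expHom (ν : Cochar A) : ℂ →+ Additive (Points A ℂ) where
  toFun z := .ofMul (ν.evalAt (expUnit z))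
  map_zero' := by
    have h := ν.evalAt_mul_right 1 1
    rw [mul_one, left_eq_mul] at h
    rw [expUnit_zero, h]
    rfl
  map_add' z w := by
    rw [expUnit_add, Cochar.evalAt_mul_right]
    rfl

theorem Cochar.expHom_mul (ν μ : Cochar A) :
    (ν * μ).expHom = ν.expHom + μ.expHom :=
  AddMonoidHom.ext fun z => congrArg Additive.ofMul (Cochar.evalAt_mul ν μ (expUnit z))

variable (A) in
/-- The exponential map `Lie T = ℂ ⊗ X_*(𝐓) → 𝐓(ℂ)`, `z ⊗ ν ↦ ν(exp z)`. -/
def torusExp : ℂ ⊗[ℤ] Additive (Cochar A) →+ Additive (Points A ℂ) :=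
  TensorProduct.liftAddHom
    (AddMonoidHom.flip (AddMonoidHom.mk' (fun ν : Additive (Cochar A) => ν.toMul.expHom)
      fun ν μ => Cochar.expHom_mul ν.toMul μ.toMul))
    fun k z ν => by
      simp only [AddMonoidHom.flip_apply, map_zsmul, AddMonoidHom.coe_smul, Pi.smul_apply]

theorem torusExp_tmul (z : ℂ) (ν : Additive (Cochar A)) :
    torusExp A (z ⊗ₜ ν) = .ofMul (ν.toMul.evalAt (expUnit z)) := rfl

variable (A) in
/-- Complex conjugation on `Lie T = ℂ ⊗ X_*(𝐓)`. -/
def lieConj : ℂ ⊗[ℤ] Additive (Cochar A) →+ ℂ ⊗[ℤ] Additive (Cochar A) :=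
  (TensorProduct.map (starRingEnd ℂ : ℂ →+ ℂ).toIntLinearMap
    (DistribSMul.toAddMonoidHom (Additive (Cochar A)) conj).toIntLinearMap).toAddMonoidHom

theorem lieConj_tmul (z : ℂ) (ν : Additive (Cochar A)) :
    lieConj A (z ⊗ₜ ν) = starRingEnd ℂ z ⊗ₜ (conj • ν) := rfl

theorem lieConj_lieConj (v : ℂ ⊗[ℤ] Additive (Cochar A)) : lieConj A (lieConj A v) = v := by
  induction v with
  | zero => simp
  | add v w hv hw => rw [map_add, map_add, hv, hw]
  | tmul z ν => rw [lieConj_tmul, lieConj_tmul, Complex.conj_conj, conj_smul_conj_smul]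

theorem lieConj_smul (z : ℂ) (v : ℂ ⊗[ℤ] Additive (Cochar A)) :
    lieConj A (z • v) = starRingEnd ℂ z • lieConj A v := by
  induction v with
  | zero => simp
  | add v w hv hw => rw [smul_add, map_add, map_add, hv, hw, smul_add]
  | tmul w ν =>
    rw [TensorProduct.smul_tmul', lieConj_tmul, lieConj_tmul, TensorProduct.smul_tmul',
      smul_eq_mul, smul_eq_mul, map_mul]

theorem torusExp_lieConj (v : ℂ ⊗[ℤ] Additive (Cochar A)) :
    torusExp A (lieConj A v) = conj • torusExp A v := by
  induction v with
  | zero => simp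
  | add v w hv hw => rw [map_add, map_add, map_add, hv, hw, smul_add]
  | tmul z ν =>
    rw [lieConj_tmul, torusExp_tmul, torusExp_tmul]
    refine congrArg Additive.ofMul ((Cochar.smul_evalAt conj ν.toMul _).trans ?_)
    congr 2
    rw [inv_smul_eq_iff]
    exact Units.ext (Complex.exp_conj z)

variable (A) in
/-- The homomorphism `ν ↦ πi ⊗ ν`. -/
def piITensor : Additive (Cochar A) →+ ℂ ⊗[ℤ] Additive (Cochar A) :=
  (TensorProduct.mk ℤ ℂ (Additive (Cochar A)) (Real.pi * Complex.I)).toAddMonoidHom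

theorem piITensor_apply (ν : Additive (Cochar A)) :
    piITensor A ν = (Real.pi * Complex.I : ℂ) ⊗ₜ ν := rfl

/-- The sign comes from conj i = -i; it is the twist that compensates the degree shift in
cohomology. -/
theorem lieConj_piITensor (ν : Additive (Cochar A)) :
    lieConj A (piITensor A ν) = -piITensor A (conj • ν) := by
  rw [piITensor_apply, piITensor_apply, lieConj_tmul, map_mul, Complex.conj_I, Complex.conj_ofReal,
    mul_neg, TensorProduct.neg_tmul]

theorem torusExp_piITensor (ν : Additive (Cochar A)) :
    torusExp A (piITensor A ν) = ev A ν := by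
  rw [piITensor_apply, torusExp_tmul]
  have : expUnit (Real.pi * Complex.I) = -1 := Units.ext Complex.exp_pi_mul_I
  rw [this]
  rfl

variable {n : ℕ} (e : ℂ ⊗[ℝ] A ≃ₐc[ℂ] AddMonoidAlgebra ℂ (Fin n → ℤ))

/-- The basis of `Lie T` dual to the basis of characters. -/
def lieBasis : Module.Basis (Fin n) ℂ (ℂ ⊗[ℤ] Additive (Cochar A)) := (cocharBasis e).baseChange ℂ

theorem lieBasis_repr_tmul (z : ℂ) (ν : Additive (Cochar A)) (j : Fin n) :
    (lieBasis e).repr (z ⊗ₜ ν) j = (cocharBasis e).repr ν j • z :=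
  Module.Basis.baseChange_repr_tmul _ _ _ _ _

/-- In the coordinates dual to the characters, `torusExp` is the ordinary exponential in each
variable. Its surjectivity and its kernel are then known from ℂ. -/
theorem torusExp_baseChange_character (v : ℂ ⊗[ℤ] Additive (Cochar A)) (j : Fin n) :
    (torusExp A v).toMul.baseChange (character e (Pi.single j 1)) =
      Complex.exp ((lieBasis e).repr v j) := by
  induction v with
  | zero => simpa using one_baseChange_character e _
  | add v w hv hw =>
    rw [map_add (torusExp A), toMul_add,
      Points.baseChange_mul_apply _ _ (isGroupLikeElem_character e _), hv, hw, map_add,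
      Finsupp.add_apply, Complex.exp_add]
  | tmul z ν =>
    rw [torusExp_tmul, lieBasis_repr_tmul, cocharBasis_repr, ← val_expUnit_zpow]
    exact Cochar.baseChange_evalAt_character e _ _ _

/-- The principal logarithm of a point of `𝐓(ℂ)`, in the coordinates given by the basis of
characters. -/
def torusLog (t : Points A ℂ) : ℂ ⊗[ℤ] Additive (Cochar A) :=
  (lieBasis e).equivFun.symm fun j => Complex.log (t.baseChange (character e (Pi.single j 1)))

theorem lieBasis_repr_torusLog (t : Points A ℂ) (j : Fin n) :
    (lieBasis e).repr (torusLog e t) j =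
      Complex.log (t.baseChange (character e (Pi.single j 1))) := by
  rw [torusLog, ← Module.Basis.equivFun_apply, LinearEquiv.apply_symm_apply]

theorem torusExp_torusLog (t : Points A ℂ) : torusExp A (torusLog e t) = .ofMul t := by
  apply Additive.toMul.injective
  refine Points.ext_character e fun j => ?_
  rw [torusExp_baseChange_character, lieBasis_repr_torusLog]
  exact Complex.exp_log (charValue e t (Pi.single j 1)).toMul.ne_zero

theorem lieBasis_repr_piITensor (ν : Additive (Cochar A)) (j : Fin n) :
    (lieBasis e).repr (piITensor A ν) j = (cocharBasis e).repr ν j * (Real.pi * Complex.I) := by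
  rw [piITensor_apply, lieBasis_repr_tmul, zsmul_eq_mul]

/-- Each coordinate of v lies in 2πiℤ, and the integers so obtained are the coordinates of ν. -/
theorem exists_eq_two_smul_piITensor (v : ℂ ⊗[ℤ] Additive (Cochar A)) (h : torusExp A v = 0) :
    ∃ ν, v = (2 : ℂ) • piITensor A ν := by
  obtain ⟨n, ⟨e⟩⟩ := IsRealTorus.exists_equiv (A := A)
  have h1 : ∀ j, ∃ k : ℤ, (lieBasis e).repr v j = k * (2 * Real.pi * Complex.I) := fun j => by
    rw [← Complex.exp_eq_one_iff, ← torusExp_baseChange_character, h]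
    exact one_baseChange_character e _
  choose k hk using h1
  refine ⟨(cocharBasis e).equivFun.symm k, (lieBasis e).ext_elem fun j => ?_⟩
  rw [hk, map_smul, Finsupp.smul_apply, lieBasis_repr_piITensor, ← Module.Basis.equivFun_apply,
    LinearEquiv.apply_symm_apply, smul_eq_mul]
  ring

variable (A) in
theorem piITensor_injective : Function.Injective (piITensor A) := fun ν μ h => by
  obtain ⟨n, ⟨e⟩⟩ := IsRealTorus.exists_equiv (A := A)
  refine (cocharBasis e).ext_elem fun j => ?_
  have h1 := congrArg (fun v => (lieBasis e).repr v j) h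
  simpa [lieBasis_repr_piITensor, Real.pi_ne_zero] using h1

variable (A) in
theorem torusExp_surjective : Function.Surjective (torusExp A) := fun t => by
  obtain ⟨n, ⟨e⟩⟩ := IsRealTorus.exists_equiv (A := A)
  exact ⟨_, torusExp_torusLog e t.toMul⟩

variable (A) in
/-- Evaluation at `-1` induces isomorphisms `H^k X_*(𝐓) ≅ H^k 𝐓`. -/
theorem tateHMap_ev_bijective (k : ℤ) : Function.Bijective (tateHMap (ev A) k) :=
  tateHMap_bijective_of_exp (ev A) (torusExp A) (lieConj A) (piITensor A) lieConj_lieConj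
    torusExp_lieConj lieConj_piITensor (piITensor_injective A) torusExp_piITensor
    (torusExp_surjective A) exists_eq_two_smul_piITensor k

end Exponential

/-! ### Connected components of 𝐓(ℝ) -/

section Components

variable {A : Type*} [CommRing A] [HopfAlgebra ℝ A]

theorem realToComplex_injective : Function.Injective (realToComplex (A := A)) := fun s t h => by
  apply ofConv_injective
  ext a
  exact Complex.ofReal_injective (DFunLike.congr_fun (congrArg ofConv h) a)

theorem exists_realToComplex_eq {t : Points A ℂ} (h : conj • t = t) :
    ∃ r : Points A ℝ, realToComplex r = t := by
  have hre : ∀ a, ((t a).re : ℂ) = t a := fun a =>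
    Complex.conj_eq_iff_re.1 (DFunLike.congr_fun (congrArg ofConv h) a)
  let r : A →ₐ[ℝ] ℝ :=
    { toFun := fun a => (t a).re
      map_one' := congrArg Complex.re (map_one t.ofConv)
      map_mul' := fun a b => Complex.ofReal_injective <| by
        rw [Complex.ofReal_mul, hre, hre, hre]
        exact map_mul t.ofConv a b
      map_zero' := congrArg Complex.re (map_zero t.ofConv)
      map_add' := fun a b => congrArg Complex.re (map_add t.ofConv a b)
      commutes' := fun x => congrArg Complex.re (t.ofConv.commutes x) }
  exact ⟨toConv r, ofConv_injective (AlgHom.ext hre)⟩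

theorem continuous_realPoint_iff {X : Type*} [TopologicalSpace X] {ρ : X → Points A ℝ} :
    Continuous ρ ↔ ∀ a, Continuous fun x => realToComplex (ρ x) a := by
  refine ⟨fun h a => Complex.continuous_ofReal.comp ((continuous_point_apply a).comp h),
    fun h => continuous_induced_rng.2 (continuous_pi fun a => ?_)⟩
  exact Complex.continuous_re.comp (h a)

theorem continuous_evalGm {X : Type*} [TopologicalSpace X] {z : X → ℂˣ} (hz : Continuous z)
    (p : ℂ[T;T⁻¹]) : Continuous fun x => evalGm (z x) p := by
  induction p using LaurentPolynomial.induction_on' with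
  | add p q hp hq => simp only [map_add]; exact hp.add hq
  | C_mul_T k c =>
    simp only [map_mul, evalGm_T]
    refine Continuous.mul ?_ (Units.continuous_val.comp (hz.zpow k))
    have : ∀ x, evalGm (z x) (.C c) = c := fun x => (evalGm (z x)).commutes c
    simp only [this]
    exact continuous_const

variable [IsRealTorus A]

theorem continuous_expUnit : Continuous expUnit := by
  refine Units.continuous_iff.2 ⟨Complex.continuous_exp, ?_⟩
  have : (fun z : ℂ => ((expUnit z)⁻¹ : ℂˣ).val) = fun z => Complex.exp (-z) :=
    funext fun z => by rw [Complex.exp_neg]; exact Units.val_inv_eq_inv_val _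
  rw [this]
  fun_prop

/-- The quantifier over a stays inside the induction: for a sum of vectors, the comultiplication of
a brings in other regular functions. -/
theorem continuous_torusExp_smul (v : ℂ ⊗[ℤ] Additive (Cochar A)) :
    ∀ a : A, Continuous fun x : ℝ => (torusExp A ((x : ℂ) • v)).toMul a := by
  induction v with
  | zero => intro a; simpa using continuous_const
  | add v w hv hw =>
    intro a
    simp only [smul_add, map_add, toMul_add, Points.mul_apply]
    exact continuous_finsetSum _ fun i _ => (hv _).mul (hw _)
  | tmul z ν =>
    intro a
    have h : ∀ x : ℝ, (torusExp A ((x : ℂ) • z ⊗ₜ ν)).toMul a =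
        evalGm (expUnit (x * z)) (ν.toMul (1 ⊗ₜ a)) := fun x => by
      rw [TensorProduct.smul_tmul', torusExp_tmul]
      rfl
    simp only [h]
    exact continuous_evalGm (continuous_expUnit.comp
      (Complex.continuous_ofReal.mul continuous_const)) _

theorem realToH0_eq_zero_iff (t : Points A ℝ) : realToH0 A (.ofMul t) = 0 ↔
    ∃ s : Additive (Points A ℂ), conj • s + s = .ofMul (realToComplex t) := by
  refine (QuotientAddGroup.eq_zero_iff _).trans (AddSubgroup.mem_addSubgroupOf.trans ?_)
  refine mem_tateB_iff.trans ?_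
  simp only [Int.negOnePow_zero, Units.val_one, one_smul]
  rfl

theorem realToH0_surjective : Function.Surjective (realToH0 A) := fun x => by
  induction x using QuotientAddGroup.induction_on with | H x => ?_
  obtain ⟨t, ht⟩ := x
  have h := mem_tateZ_iff.1 ht
  rw [Int.negOnePow_zero, Units.val_one, one_smul] at h
  obtain ⟨r, hr⟩ := exists_realToComplex_eq (t := t.toMul) h
  exact ⟨.ofMul r, congrArg QuotientAddGroup.mk (Subtype.ext (congrArg Additive.ofMul hr))⟩

theorem mem_connectedComponent_of_realToH0_eq_zero {t : Points A ℝ}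
    (h : realToH0 A (.ofMul t) = 0) : t ∈ connectedComponent (1 : Points A ℝ) := by
  obtain ⟨s, hs⟩ := (realToH0_eq_zero_iff t).1 h
  obtain ⟨v, rfl⟩ := torusExp_surjective A s
  rw [← torusExp_lieConj, ← map_add] at hs
  -- The norm of exp v is exp w with w fixed by conjugation, so exp(xw) is a real point for every
  -- real x.
  set w := lieConj A v + v with hw
  have hcw : lieConj A w = w := by rw [hw, map_add, lieConj_lieConj, add_comm]
  have hx : ∀ x : ℝ, ∃ r : Points A ℝ, realToComplex r = (torusExp A ((x : ℂ) • w)).toMul :=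
    fun x => exists_realToComplex_eq <| by
      have := torusExp_lieConj ((x : ℂ) • w)
      rw [lieConj_smul, Complex.conj_ofReal, hcw] at this
      exact this.symm
  choose ρ hρ using hx
  have hcont : Continuous ρ := continuous_realPoint_iff.2 fun a => by
    simp only [hρ]
    exact continuous_torusExp_smul w a
  have h0 : ρ 0 = 1 := realToComplex_injective <| by
    rw [hρ, map_one, Complex.ofReal_zero, zero_smul, map_zero]
    rfl
  have h1 : ρ 1 = t := realToComplex_injective <| by
    rw [hρ, Complex.ofReal_one, one_smul, hs]
    rfl
  rw [← h1]
  exact (isPreconnected_range hcont).subset_connectedComponent ⟨0, h0⟩ ⟨1, rfl⟩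

variable (A) in
/-- The homomorphism `realToH0`, written multiplicatively. -/
def realToH0Mul : Points A ℝ →* Multiplicative (TateH (Additive (Points A ℂ)) 0) :=
  AddMonoidHom.toMultiplicativeRight (realToH0 A)

theorem mem_ker_realToH0Mul {t : Points A ℝ} :
    t ∈ (realToH0Mul A).ker ↔ realToH0 A (.ofMul t) = 0 := Iff.rfl

variable (A) in
theorem isOpen_ker_realToH0Mul : IsOpen ((realToH0Mul A).ker : Set (Points A ℝ)) := by
  obtain ⟨n, ⟨e⟩⟩ := IsRealTorus.exists_equiv (A := A)
  -- A subgroup is open once it is a neighbourhood of 1, where the principal logarithm is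
  -- continuous.
  apply Subgroup.isOpen_of_mem_nhds (g := 1)
  have hlog : ∀ j, ContinuousAt
      (fun t : Points A ℝ => (lieBasis e).repr (torusLog e (realToComplex t)) j) 1 := fun j => by
    simp only [lieBasis_repr_torusLog]
    refine (continuous_baseChange_realToComplex _).continuousAt.clog ?_
    rw [map_one, one_baseChange_character]
    exact Complex.one_mem_slitPlane
  -- Conjugation is only semilinear, so its coordinates are written out explicitly to make their
  -- continuity visible.
  have hconj : ∀ v i, (lieBasis e).repr (lieConj A v - v) i = (∑ j,
      starRingEnd ℂ ((lieBasis e).repr v j) * (lieBasis e).repr (lieConj A (lieBasis e j)) i) -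
        (lieBasis e).repr v i := by
    intro v i
    rw [map_sub, Finsupp.sub_apply]
    congr 1
    have h := congrArg (fun v => (lieBasis e).repr (lieConj A v) i) ((lieBasis e).sum_repr v)
    simp only [map_sum, lieConj_smul, map_smul, Finsupp.finsetSum_apply, Finsupp.smul_apply,
      smul_eq_mul] at h
    exact h.symm
  have hcont : ∀ i, ContinuousAt (fun t : Points A ℝ => (lieBasis e).repr
      (lieConj A (torusLog e (realToComplex t)) - torusLog e (realToComplex t)) i) 1 := by
    intro i
    simp only [hconj]
    refine ContinuousAt.sub (tendsto_finsetSum _ fun j _ => ?_) (hlog i)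
    exact ((Complex.continuous_conj.continuousAt.comp (hlog j)).mul continuousAt_const)
  have hone : torusLog e (1 : Points A ℂ) = 0 := (lieBasis e).ext_elem fun j => by
    rw [lieBasis_repr_torusLog, one_baseChange_character, Complex.log_one, map_zero]
    rfl
  have hev : ∀ᶠ t : Points A ℝ in nhds 1, ∀ i, ‖(lieBasis e).repr
      (lieConj A (torusLog e (realToComplex t)) - torusLog e (realToComplex t)) i‖ <
        2 * Real.pi := by
    refine Filter.eventually_all.2 fun i => (hcont i).norm.eventually_lt continuousAt_const ?_
    rw [map_one, hone, map_zero, sub_zero, map_zero, Finsupp.zero_apply, norm_zero]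
    exact Real.two_pi_pos
  refine Filter.mem_of_superset hev fun t ht => ?_
  rw [SetLike.mem_coe, mem_ker_realToH0Mul, realToH0_eq_zero_iff]
  set v := torusLog e (realToComplex t)
  have hv : torusExp A v = .ofMul (realToComplex t) := torusExp_torusLog e _
  have hfix : conj • torusExp A v = torusExp A v := by
    have := (realToZ0 (.ofMul t)).2
    rw [mem_tateZ_iff, Int.negOnePow_zero, Units.val_one, one_smul] at this
    rwa [hv]
  obtain ⟨a, ha⟩ := exists_eq_two_smul_piITensor (lieConj A v - v) (by
    rw [map_sub, torusExp_lieConj, hfix, sub_self])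
  -- The coordinates of γv - v are integer multiples of 2πi of norm less than 2π, so they vanish.
  have ha0 : a = 0 := (cocharBasis e).ext_elem fun i => by
    have h : ‖(lieBasis e).repr (lieConj A v - v) i‖ < 2 * Real.pi := ht i
    rw [ha, map_smul, Finsupp.smul_apply, lieBasis_repr_piITensor, smul_eq_mul, norm_mul, norm_mul,
      norm_mul, Complex.norm_I, Complex.norm_real, Real.norm_of_nonneg Real.pi_pos.le,
      Complex.norm_intCast, Complex.norm_ofNat] at h
    have h2 : |(((cocharBasis e).repr a i : ℤ) : ℝ)| < 1 := by
      have := Real.pi_pos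
      by_contra! h3
      nlinarith
    rw [← Int.cast_abs, ← Int.cast_one, Int.cast_lt, Int.abs_lt_one_iff] at h2
    simpa using h2
  rw [ha0, map_zero, smul_zero, sub_eq_zero] at ha
  -- As v is now fixed by conjugation, the norm of exp(v/2) is exp(v/2 + v/2) = exp v.
  refine ⟨torusExp A ((2⁻¹ : ℂ) • v), ?_⟩
  rw [← torusExp_lieConj, ← map_add, lieConj_smul, ha, ← add_smul, ← hv]
  have h2 : starRingEnd ℂ 2⁻¹ + 2⁻¹ = 1 := by
    rw [map_inv₀, Complex.conj_ofNat]
    norm_num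
  rw [h2, one_smul]

variable (A) in
theorem connectedComponentOfOne_eq_ker :
    Subgroup.connectedComponentOfOne (Points A ℝ) = (realToH0Mul A).ker := by
  refine le_antisymm (fun t ht => ?_) fun t ht => mem_connectedComponent_of_realToH0_eq_zero ht
  have hopen := isOpen_ker_realToH0Mul A
  -- An open subgroup is also closed, so it contains the component of 1.
  exact IsClopen.connectedComponent_subset
    ⟨Subgroup.isClosed_of_isOpen _ hopen, hopen⟩ (one_mem _) ht

variable (A) in
/-- The isomorphism `π₀ 𝐓(ℝ) ≅ H⁰ 𝐓` induced by `t ↦ [t]`. -/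
def piZeroEquiv : Additive (PiZeroReal A) ≃+ TateH (Additive (Points A ℂ)) 0 :=
  AddEquiv.toMultiplicativeRight.symm <|
    (QuotientGroup.quotientMulEquivOfEq (connectedComponentOfOne_eq_ker A)).trans
      (QuotientGroup.quotientKerEquivOfSurjective (realToH0Mul A) realToH0_surjective)

theorem piZeroEquiv_mk (t : Points A ℝ) :
    piZeroEquiv A (.ofMul (QuotientGroup.mk t)) = realToH0 A (.ofMul t) := rfl

end Components

end RealTori

end

open RealTori
theorem mainTheorem7 {A : Type*} [CommRing A] [HopfAlgebra ℝ A] [IsRealTorus A] :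
    (∀ k : ℤ, Function.Bijective (tateHMap (ev A) k)) ∧
      ∃ φ : Additive (PiZeroReal A) ≃+ TateH (Additive (Points A ℂ)) 0,
        (∀ t : Points A ℝ, φ (.ofMul (QuotientGroup.mk t)) = realToH0 A (.ofMul t)) ∧
        ∃ ψ : TateH (Additive (Cochar A)) 0 ≃+ Additive (PiZeroReal A),
          ∀ x, φ (ψ x) = tateHMap (ev A) 0 x := by
  refine ⟨tateHMap_ev_bijective A, piZeroEquiv A, piZeroEquiv_mk,
    (AddEquiv.ofBijective (tateHMap (ev A) 0) (tateHMap_ev_bijective A 0)).trans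
      (piZeroEquiv A).symm, fun x => ?_⟩
  exact (piZeroEquiv A).apply_symm_apply _
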